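/- Let $\mathcal A$ be a finite alphabet with $k=\#\mathcal A$ letters and let $\mathbf u=u_0u_1u_2\cdots$ be an infinite word over $\mathcal A$ in which every letter of $\mathcal A$ occurs. A factor of $\mathbf u$ is a finite word $w$ (possibly empty) such that $w=u_iu_{i+1}\cdots u_{i+|w|-1}$ for some $i\ge 0$; such an $i$ is called an occurrence of $w$. Assume that (1) $\mathbf u$ is uniformly recurrent, i.e. $\mathbf u$ is recurrent (every factor has at least two occurrences, equivalently infinitely many) and for every factor the distances between its successive occurrences are bounded; (2) $\mathbf u$ satisfies Property $\mathcal C$: for every $n\ge 0$, $\mathbf u$ has exactly $(k-1)n+1$ distinct factors of length $n$; (3) $\mathbf u$ satisfies Property $\mathcal{PE}$: for every palindromic factor $w$ of $\mathbf u$ (including the empty word) there is exactly one palindromic extension, i.e. exactly one word of the form $awa$ with $a\in\mathcal A$ that is a factor of $\mathbf u$. Then $\mathbf u$ satisfies Property $\mathcal R$: every factor $w$ of $\mathbf u$ (including the empty word) has exactly $k$ return words, where the return words of $w$ are the words $u_iu_{i+1}\cdots u_{j-1}$ with $i<j$ two successive occurrences of $w$ in $\mathbf u$. -/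

import Mathlib

/-! Infinite words over an alphabet `A` are maps `u : ℕ → A`; finite words are lists. -/

namespace InfWord

variable {A : Type*}

/-- The finite word `u_i u_{i+1} ⋯ u_{i+n-1}`. -/
def subword (u : ℕ → A) (i n : ℕ) : List A :=
  (List.range n).map fun j => u (i + j)

/-- `i` is an occurrence of the finite word `w` in `u`: the word `w` is a prefix of
`u_i u_{i+1} u_{i+2} ⋯`. -/
def IsOccurrence (u : ℕ → A) (w : List A) (i : ℕ) : Prop :=
  subword u i w.length = w

/-- The language of `u`: the set of all its factors (the empty word included). -/
def language (u : ℕ → A) : Set (List A) :=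
  {w | ∃ i, IsOccurrence u w i}

/-- The factor complexity: the number of factors of length `n`. -/
noncomputable def complexity (u : ℕ → A) (n : ℕ) : ℕ :=
  Set.ncard {w | w ∈ language u ∧ w.length = n}

/-- `i < j` are two successive occurrences of `w` in `u`. -/
def SuccessiveOccurrences (u : ℕ → A) (w : List A) (i j : ℕ) : Prop :=
  i < j ∧ IsOccurrence u w i ∧ IsOccurrence u w j ∧
    ∀ m, i < m → m < j → ¬ IsOccurrence u w m

/-- Every factor has at least two occurrences. -/
def Recurrent (u : ℕ → A) : Prop :=
  ∀ w ∈ language u, ∃ i j, i < j ∧ IsOccurrence u w i ∧ IsOccurrence u w j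

/-- `u` is recurrent and, for every factor, the distances between successive occurrences
are bounded. -/
def UniformlyRecurrent (u : ℕ → A) : Prop :=
  Recurrent u ∧
    ∀ w ∈ language u, ∃ B : ℕ, ∀ i j, SuccessiveOccurrences u w i j → j - i ≤ B

/-- The set of return words of `w` in `u`: the words `u_i ⋯ u_{j-1}` for successive
occurrences `i < j` of `w`. -/
def returnWords (u : ℕ → A) (w : List A) : Set (List A) :=
  {v | ∃ i j, SuccessiveOccurrences u w i j ∧ v = subword u i (j - i)}

/-- The set of palindromic extensions of `w` in `u`: the factors `a w a` with `a` a letter. -/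
def palindromicExtensions (u : ℕ → A) (w : List A) : Set (List A) :=
  {v | v ∈ language u ∧ ∃ a : A, v = a :: (w ++ [a])}

/-- The complexity property: `C(n) = (k - 1) n + 1` for all `n ≥ 0`, where `k = #A`.
An alphabet carrying an infinite word is nonempty, so the subtraction does not truncate. -/
def PropertyC [Fintype A] (u : ℕ → A) : Prop :=
  ∀ n : ℕ, complexity u n = (Fintype.card A - 1) * n + 1

/-- Every palindromic factor (the empty word included) has a unique palindromic extension. -/
def PropertyPE (u : ℕ → A) : Prop :=
  ∀ w ∈ language u, w.Palindrome → ∃! v, v ∈ palindromicExtensions u w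

/-- Every factor (the empty word included) has exactly `k = #A` return words. -/
def PropertyR [Fintype A] (u : ℕ → A) : Prop :=
  ∀ w ∈ language u, (returnWords u w).encard = (Fintype.card A : ℕ∞)

end InfWord

namespace InfWord

open scoped Classical

variable {A : Type*}

/-! ### Factors and recurrence. -/

section Subword

variable (u : ℕ → A)

/-! Write k for the alphabet size and e(v) for the number of right extensions of v minus one
(`excess`). Call v neutral if e(v) is the sum of e(av) over its left extensions av, and weak if it
has fewer two-sided extensions avb than #left + #right - 1.

If all factors are neutral, Property R follows by counting. Extend the empty word to the left,
stopping each branch when a nonempty w first appears: uniform recurrence makes this tree finite, and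
neutrality carries e([]) = k - 1 to its leaves (`excess_eq_sum_singleOccurrence`). One more letter
on the right of each leaf gives either another leaf or a complete return word of w, and every leaf
except w arises so; this leaves k complete returns (`encard_completeReturns_of_neutral`).

Property C makes the first difference of the complexity constant, so neutrality of all factors
follows once none is weak (`excess_eq_sum_of_card_le`). To exclude weak factors, form the graph
whose vertices are the factors of length n modulo reversal and whose edges are the nonpalindromic
factors of length n + 1 modulo reversal. C and PE give it exactly one edge fewer than vertices, and
u walks through all of it, so it is a tree. A walk in a tree returns to a vertex through the edge by
which it left (`walk_backtracks`). Hence occurrences of v and its reversal alternate, and the letter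
after one is the letter before the next (`subword_backtracks`). These letters form a walk through
all one-sided extensions of v whose steps are two-sided extensions; connectedness bounds the number
of the latter from below (`not_weak_of_palindrome`, `not_weak_of_not_palindrome`). -/

@[simp] theorem length_subword (i n : ℕ) : (subword u i n).length = n := by
  simp [subword]

@[simp] theorem subword_zero (i : ℕ) : subword u i 0 = [] := rfl

theorem subword_add (i m n : ℕ) :
    subword u i (m + n) = subword u i m ++ subword u (i + m) n := by
  simp [subword, List.range_add, Function.comp_def, add_assoc]

theorem subword_succ (i n : ℕ) : subword u i (n + 1) = subword u i n ++ [u (i + n)] := by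
  rw [subword_add]; simp [subword]

theorem subword_succ_eq_cons (i n : ℕ) :
    subword u i (n + 1) = u i :: subword u (i + 1) n := by
  rw [add_comm n 1, subword_add]; simp [subword]

theorem subword_mem_language (i n : ℕ) : subword u i n ∈ language u :=
  ⟨i, by simp [IsOccurrence]⟩

variable {u}

theorem subword_congr_of_le {i j m n : ℕ} (h : subword u i n = subword u j n) (hm : m ≤ n) :
    subword u i m = subword u j m := by
  obtain ⟨d, rfl⟩ := Nat.exists_eq_add_of_le hm
  rw [subword_add, subword_add] at h
  exact (List.append_inj h (by simp)).1

theorem subword_eq_append {i n : ℕ} {x y : List A} (h : subword u i n = x ++ y) :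
    subword u i x.length = x ∧ subword u (i + x.length) y.length = y := by
  have hn : n = x.length + y.length := by simpa using congrArg List.length h
  subst hn
  rw [subword_add] at h
  exact List.append_inj h (by simp)

theorem infix_subword_iff {w : List A} {i n : ℕ} :
    w <:+: subword u i n ↔ ∃ m, i ≤ m ∧ m + w.length ≤ i + n ∧ IsOccurrence u w m := by
  constructor
  · rintro ⟨x, y, h⟩
    have hl := congrArg List.length h
    obtain ⟨h1, -⟩ := subword_eq_append h.symm
    simp only [List.length_append, length_subword] at hl h1
    rw [subword_add] at h1
    exact ⟨i + x.length, by omega, by omega, (List.append_inj h1 (by simp)).2⟩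
  · rintro ⟨m, h1, h2, h3⟩
    obtain ⟨d, rfl⟩ := Nat.exists_eq_add_of_le h1
    obtain ⟨e, rfl⟩ : ∃ e, n = d + w.length + e := ⟨n - d - w.length, by omega⟩
    rw [subword_add, subword_add, h3]
    exact ⟨_, _, rfl⟩

theorem language_of_infix {v w : List A} (hw : w ∈ language u) (h : v <:+: w) :
    v ∈ language u := by
  obtain ⟨i, hi⟩ := hw
  rw [← hi, infix_subword_iff] at h
  obtain ⟨m, -, -, hm⟩ := h
  exact ⟨m, hm⟩

theorem exists_subword_eq_of_append_mem {v : List A} {b : A} (h : v ++ [b] ∈ language u) :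
    ∃ i, subword u i v.length = v ∧ u (i + v.length) = b := by
  obtain ⟨i, hi⟩ := h
  have := subword_eq_append hi
  exact ⟨i, this.1, by simpa [subword] using this.2⟩

theorem Recurrent.exists_occurrence_gt (h : Recurrent u) {w : List A} (hw : w ∈ language u)
    (N : ℕ) : ∃ i, N < i ∧ IsOccurrence u w i := by
  induction N with
  | zero =>
    obtain ⟨i, j, hij, -, hj⟩ := h w hw
    exact ⟨j, by omega, hj⟩
  | succ N ih =>
    obtain ⟨i, hi, ho⟩ := ih
    -- A second occurrence of the prefix ending with this copy of `w`, at a position `b ≥ 1`,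
    -- carries a copy of `w` to `b + i > i`.
    obtain ⟨a, b, hab, -, hb⟩ := h _ (subword_mem_language u 0 (i + w.length))
    rw [IsOccurrence, length_subword, subword_add, subword_add] at hb
    have := (List.append_inj hb (by simp)).2
    refine ⟨b + i, by omega, ?_⟩
    rw [IsOccurrence, this, zero_add, ho]

/-- Gaps are bounded by `B` only after the first known occurrence `i₀`; adding `i₀` to the bound
covers windows starting before it. Otherwise the last occurrence up to `i` and the first one after
`i` are successive. -/
theorem UniformlyRecurrent.exists_infix_of_le (h : UniformlyRecurrent u) {w : List A}
    (hw : w ∈ language u) :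
    ∃ N, ∀ v ∈ language u, N ≤ v.length → w <:+: v := by
  obtain ⟨i₀, hi₀⟩ := hw
  obtain ⟨B, hB⟩ := h.2 w ⟨i₀, hi₀⟩
  refine ⟨i₀ + B + w.length, ?_⟩
  rintro v ⟨i, hi⟩ hl
  rw [← hi, infix_subword_iff]
  rcases le_or_gt i i₀ with hle | hlt
  · exact ⟨i₀, hle, by omega, hi₀⟩
  · have hP : ∃ m, i < m ∧ IsOccurrence u w m := h.1.exists_occurrence_gt ⟨i₀, hi₀⟩ i
    obtain ⟨hs1, hs2⟩ := Nat.find_spec hP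
    have hj1 := Nat.findGreatest_le (P := IsOccurrence u w) i
    have hj2 : IsOccurrence u w (Nat.findGreatest (IsOccurrence u w) i) :=
      Nat.findGreatest_spec hlt.le hi₀
    have := hB _ _ ⟨by omega, hj2, hs2, fun m hm1 hm2 hm => ?_⟩
    · exact ⟨Nat.find hP, by omega, by omega, hs2⟩
    · rcases le_or_gt m i with h1 | h1
      · exact Nat.findGreatest_is_greatest hm1 h1 hm
      · exact Nat.find_min hP hm2 ⟨h1, hm⟩

end Subword

/-! ### Extension counts and neutrality. -/

section Extensions

variable [Fintype A] (u : ℕ → A)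

/-- The factors of length `n`. -/
noncomputable def factors (n : ℕ) : Finset (List A) :=
  ((List.finite_length_eq A n).subset
    (fun _ h => h.2 : {w | w ∈ language u ∧ w.length = n} ⊆ _)).toFinset

/-- The right extensions of a word, as letters. -/
noncomputable def rightExt (v : List A) : Finset A := {b | v ++ [b] ∈ language u}

/-- The left extensions of a word, as letters. -/
noncomputable def leftExt (v : List A) : Finset A := {a | a :: v ∈ language u}

/-- The pairs of letters extending a word on both sides. -/
noncomputable def biExt (v : List A) : Finset (A × A) :=
  {x | x.1 :: (v ++ [x.2]) ∈ language u}

/-- The number of right extensions minus one. -/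
noncomputable def excess (v : List A) : ℤ := (rightExt u v).card - 1

variable {u}

@[simp] theorem mem_factors {n : ℕ} {w : List A} :
    w ∈ factors u n ↔ w ∈ language u ∧ w.length = n := by
  simp [factors]

@[simp] theorem mem_rightExt {v : List A} {b : A} :
    b ∈ rightExt u v ↔ v ++ [b] ∈ language u := by
  simp [rightExt]

@[simp] theorem mem_leftExt {v : List A} {a : A} :
    a ∈ leftExt u v ↔ a :: v ∈ language u := by
  simp [leftExt]

@[simp] theorem mem_biExt {v : List A} {x : A × A} :
    x ∈ biExt u v ↔ x.1 :: (v ++ [x.2]) ∈ language u := by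
  simp [biExt]

theorem card_factors (n : ℕ) : (factors u n).card = complexity u n :=
  (Set.ncard_eq_toFinset_card _ _).symm

theorem sum_factors_succ {M : Type*} [AddCommMonoid M] (f : List A → M) (n : ℕ) :
    ∑ v ∈ factors u (n + 1), f v = ∑ v ∈ factors u n, ∑ a ∈ leftExt u v, f (a :: v) := by
  rw [Finset.sum_sigma']
  symm
  refine Finset.sum_bij (fun x _ => x.2 :: x.1) ?_ ?_ ?_ (fun _ _ => rfl)
  · rintro ⟨v, a⟩ h
    simp only [Finset.mem_sigma, mem_factors, mem_leftExt] at h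
    simp [h.1.2, h.2]
  · rintro ⟨v, a⟩ - ⟨v', a'⟩ - h
    simp only [List.cons.injEq] at h
    obtain ⟨rfl, rfl⟩ := h
    rfl
  · rintro (_ | ⟨a, v⟩) h
    · simp at h
    · simp only [mem_factors, List.length_cons, add_left_inj] at h
      exact ⟨⟨v, a⟩, by
        simpa [h.1, h.2] using language_of_infix h.1 (List.suffix_cons a v).isInfix, rfl⟩

theorem card_factors_succ (n : ℕ) :
    (factors u (n + 1)).card = ∑ v ∈ factors u n, (rightExt u v).card := by
  rw [← Finset.card_sigma]
  symm
  refine Finset.card_bij (fun x _ => x.1 ++ [x.2]) ?_ ?_ ?_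
  · rintro ⟨v, a⟩ h
    simp only [Finset.mem_sigma, mem_factors, mem_rightExt] at h
    simp [h.1.2, h.2]
  · rintro ⟨v, a⟩ - ⟨v', a'⟩ - h
    obtain ⟨rfl, h⟩ := List.append_inj' h rfl
    simp_all
  · intro w h
    rcases List.eq_nil_or_concat' w with rfl | ⟨v, a, rfl⟩
    · simp at h
    · simp only [mem_factors, List.length_append, List.length_singleton, add_left_inj] at h
      exact ⟨⟨v, a⟩, by
        simpa [h.1, h.2] using language_of_infix h.1 (List.prefix_append v [a]).isInfix, rfl⟩

theorem sum_excess_factors (n : ℕ) :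
    ∑ v ∈ factors u n, excess u v = (complexity u (n + 1) : ℤ) - complexity u n := by
  simp only [excess, Finset.sum_sub_distrib, ← card_factors, card_factors_succ]
  simp

theorem sum_excess_cons (v : List A) :
    ∑ a ∈ leftExt u v, excess u (a :: v) =
      ((biExt u v).card : ℤ) - (leftExt u v).card := by
  have : (biExt u v).card = ∑ a ∈ leftExt u v, (rightExt u (a :: v)).card := by
    rw [← Finset.card_sigma]
    refine Finset.card_bij (fun x _ => ⟨x.1, x.2⟩) ?_ ?_ ?_
    · rintro ⟨a, b⟩ h
      simp only [mem_biExt] at h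
      simpa [h] using language_of_infix h (List.prefix_append (a :: v) [b]).isInfix
    · rintro ⟨a, b⟩ - ⟨a', b'⟩ - h
      simpa using h
    · rintro ⟨a, b⟩ h
      simp only [Finset.mem_sigma, mem_rightExt, mem_leftExt] at h
      exact ⟨(a, b), by simpa using h.2, rfl⟩
  simp only [excess, Finset.sum_sub_distrib, this]
  simp

/-- If no factor is weak and the first difference of the complexity is constant, then all
factors are neutral. -/
theorem excess_eq_sum_of_card_le
    (hC : ∀ n, (complexity u (n + 2) : ℤ) - complexity u (n + 1) =
      complexity u (n + 1) - complexity u n)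
    (hle : ∀ v ∈ language u,
      (leftExt u v).card + (rightExt u v).card ≤ (biExt u v).card + 1)
    {v : List A} (hv : v ∈ language u) :
    excess u v = ∑ a ∈ leftExt u v, excess u (a :: v) := by
  have key : ∑ v ∈ factors u v.length, excess u v =
      ∑ v ∈ factors u v.length, ∑ a ∈ leftExt u v, excess u (a :: v) := by
    rw [← sum_factors_succ, sum_excess_factors, sum_excess_factors, hC]
  -- The two totals are consecutive first differences of the complexity, hence equal; a termwise
  -- inequality between equal sums is an equality in each term.
  refine (Finset.sum_eq_sum_iff_of_le ?_).1 key v (by simp [hv])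
  intro w hw
  have := hle w (mem_factors.1 hw).1
  rw [sum_excess_cons, excess]
  omega

end Extensions

/-! ### Counting return words when all factors are neutral. -/

section ReturnWords

variable {u : ℕ → A}

/-- The factors having the nonempty word `w` as a prefix and no other occurrence of `w`. -/
def singleOccurrence (u : ℕ → A) (w : List A) : Set (List A) :=
  {p | p ∈ language u ∧ w <+: p ∧ ¬ w <:+: p.tail}

/-- The complete return words of `w`: the factors in which the nonempty word `w` occurs exactly
twice, as a prefix and as a suffix. -/
def completeReturns (u : ℕ → A) (w : List A) : Set (List A) :=
  {q | q ∈ language u ∧ w <+: q.dropLast ∧ ¬ w <:+: q.dropLast.tail ∧ w <:+: q.tail}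

/-- A complete return is a return word followed by the second copy of `w`. For empty `w` the set
`completeReturns` is empty, so that case is treated apart. -/
theorem completeReturns_eq_image {w : List A} (hw : w ≠ []) :
    completeReturns u w = (fun v => v ++ w) '' returnWords u w := by
  have hwl : 0 < w.length := List.length_pos_iff.2 hw
  ext q
  constructor
  · rintro ⟨hq, hpre, hn, hin⟩
    obtain ⟨i, hi⟩ := hq
    have hlen := hpre.length_le
    rw [List.length_dropLast] at hlen
    obtain ⟨n, hn'⟩ : ∃ n, q.length = n + 2 := ⟨q.length - 2, by
      have := hin.length_le
      rw [List.length_tail] at this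
      by_contra hcon
      have h1 : w.length = 1 := by omega
      omega⟩
    rw [IsOccurrence, hn'] at hi
    have hd : q.dropLast = subword u i (n + 1) := by
      rw [← hi, subword_succ, List.dropLast_concat]
    rw [hd] at hpre hn
    rw [subword_succ_eq_cons u i n, List.tail_cons, infix_subword_iff] at hn
    rw [← hi, subword_succ_eq_cons, List.tail_cons, infix_subword_iff] at hin
    obtain ⟨t, ht⟩ := hpre
    have hoi : IsOccurrence u w i := (subword_eq_append ht.symm).1
    obtain ⟨j, hj1, hj2, hj⟩ := hin
    have hj3 : j + w.length = i + n + 2 := by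
      by_contra hcon
      exact hn ⟨j, hj1, by omega, hj⟩
    refine ⟨subword u i (j - i), ⟨i, j, ⟨by omega, hoi, hj, fun m h1 h2 hm => ?_⟩, rfl⟩, ?_⟩
    · exact hn ⟨m, h1, by omega, hm⟩
    · have : n + 2 = (j - i) + w.length := by omega
      rw [this, subword_add, show i + (j - i) = j by omega, hj] at hi
      exact hi
  · rintro ⟨v, ⟨i, j, ⟨hij, hi, hj, hm⟩, rfl⟩, rfl⟩
    obtain ⟨d, rfl⟩ : ∃ d, j = i + d + 1 := ⟨j - i - 1, by omega⟩
    obtain ⟨l, hl⟩ : ∃ l, w.length = l + 1 := ⟨w.length - 1, by omega⟩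
    have e : subword u i (i + d + 1 - i) ++ w = subword u i (d + l + 1 + 1) := by
      rw [show d + l + 1 + 1 = (i + d + 1 - i) + w.length by omega, subword_add,
        show i + (i + d + 1 - i) = i + d + 1 by omega, hj]
    simp only [e]
    have e2 : (subword u i (d + l + 1 + 1)).dropLast = subword u i (d + l + 1) := by
      rw [subword_succ, List.dropLast_concat]
    refine ⟨subword_mem_language _ _ _, ?_, ?_, ?_⟩
    · rw [e2, show d + l + 1 = w.length + d by omega, subword_add, hi]
      exact List.prefix_append _ _
    · rw [e2, subword_succ_eq_cons, List.tail_cons, infix_subword_iff]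
      rintro ⟨m, h1, h2, h3⟩
      exact hm m (by omega) (by omega) h3
    · rw [subword_succ_eq_cons, List.tail_cons, infix_subword_iff]
      exact ⟨i + d + 1, by omega, by omega, hj⟩

theorem encard_completeReturns {w : List A} (hw : w ≠ []) :
    (completeReturns u w).encard = (returnWords u w).encard := by
  rw [completeReturns_eq_image hw]
  exact Function.Injective.encard_image (fun _ _ h => List.append_cancel_right h) _

theorem encard_returnWords_nil [Fintype A] (hsurj : Function.Surjective u) :
    (returnWords u []).encard = Fintype.card A := by
  have : returnWords u [] = Set.range (fun a : A => [a]) := by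
    ext v
    constructor
    · rintro ⟨i, j, ⟨hij, -, -, hm⟩, rfl⟩
      have : j = i + 1 := by
        by_contra h
        exact hm (i + 1) (by omega) (by omega) rfl
      subst this
      exact ⟨u i, by simp [subword]⟩
    · rintro ⟨a, rfl⟩
      obtain ⟨i, rfl⟩ := hsurj a
      exact ⟨i, i + 1, ⟨by omega, rfl, rfl, fun m _ _ => by omega⟩, by simp [subword]⟩
  rw [this, ← Set.image_univ, Function.Injective.encard_image (by intro a b; simp)]
  simp

variable [Fintype A]

theorem finite_singleOccurrence (hrec : UniformlyRecurrent u) {w : List A}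
    (hw : w ∈ language u) : (singleOccurrence u w).Finite := by
  obtain ⟨N, hN⟩ := hrec.exists_infix_of_le hw
  refine (List.finite_length_le A N).subset ?_
  rintro p ⟨hp, -, hn⟩
  by_contra hcon
  have hcon : ¬ p.length ≤ N := hcon
  refine hn (hN _ (language_of_infix hp (List.tail_suffix p).isInfix) ?_)
  rw [List.length_tail]
  omega

/-- Neutrality is iterated down the tree of left extensions of `v`. A branch stops when `w` appears,
necessarily as a prefix, so the leaves are the members of `X` with suffix `v`. -/
theorem excess_eq_sum_singleOccurrence (hrec : UniformlyRecurrent u)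
    (hneutral : ∀ v ∈ language u, excess u v = ∑ a ∈ leftExt u v, excess u (a :: v))
    {w : List A} {X : Finset (List A)} (hX : ∀ p, p ∈ X ↔ p ∈ singleOccurrence u w)
    (hw : w ∈ language u) {v : List A} (hv : v ∈ language u) (hwv : ¬ w <:+: v) :
    excess u v = ∑ p ∈ X with v <:+ p, excess u p := by
  obtain ⟨N, hN⟩ := hrec.exists_infix_of_le hw
  -- `d` bounds how many letters `v` is short of the length `N` that forces an occurrence of `w`;
  -- each left extension decreases it.
  obtain ⟨d, hd⟩ : ∃ d, N ≤ v.length + d := ⟨N, by omega⟩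
  induction d generalizing v with
  | zero => exact absurd (hN v hv hd) hwv
  | succ d ih =>
    have hunion : {p ∈ X | v <:+ p} =
        (leftExt u v).biUnion (fun a => {p ∈ X | (a :: v) <:+ p}) := by
      ext p
      simp only [Finset.mem_filter, Finset.mem_biUnion, mem_leftExt]
      constructor
      · rintro ⟨hp, x, rfl⟩
        have hp' := (hX _).1 hp
        rcases List.eq_nil_or_concat' x with rfl | ⟨x, a, rfl⟩
        · exact absurd hp'.2.1.isInfix hwv
        · refine ⟨a, language_of_infix hp'.1 ⟨x, [], by simp⟩, hp, x, by simp⟩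
      · rintro ⟨a, -, hp, h⟩
        exact ⟨hp, (List.suffix_cons a v).trans h⟩
    rw [hneutral v hv, hunion, Finset.sum_biUnion]
    · refine Finset.sum_congr rfl fun a ha => ?_
      rw [mem_leftExt] at ha
      by_cases hin : w <:+: a :: v
      -- A leaf: any longer word ending in `a :: v` contains `w` in its tail.
      · have hpre : w <+: a :: v := (List.infix_cons_iff.1 hin).resolve_right hwv
        have : {p ∈ X | (a :: v) <:+ p} = {a :: v} := by
          ext p
          simp only [Finset.mem_filter, Finset.mem_singleton]
          constructor
          · rintro ⟨hp, x, rfl⟩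
            cases x with
            | nil => rfl
            | cons b x =>
              refine absurd ?_ ((hX _).1 hp).2.2
              exact hin.trans ⟨x, [], by simp⟩
          · rintro rfl
            exact ⟨(hX _).2 ⟨ha, hpre, hwv⟩, List.suffix_rfl⟩
        rw [this, Finset.sum_singleton]
      · exact ih ha hin (by rw [List.length_cons]; omega)
    · intro a _ b _ hab
      rw [Function.onFun, Finset.disjoint_left]
      intro p hp hp'
      have h1 := (Finset.mem_filter.1 hp).2
      have h2 := (Finset.mem_filter.1 hp').2
      have := List.suffix_of_suffix_length_le h1 h2 (by simp)
      have := this.eq_of_length (by simp)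
      simp_all

/-- The one-letter right extensions of `X` number k - 1 + #X. Those with no second occurrence of `w`
are the members of `X` other than `w`, so #X - 1 of them; the remaining k are the complete returns.
-/
theorem encard_completeReturns_of_neutral (hsurj : Function.Surjective u)
    (hrec : UniformlyRecurrent u)
    (hneutral : ∀ v ∈ language u, excess u v = ∑ a ∈ leftExt u v, excess u (a :: v))
    {w : List A} (hw : w ∈ language u) (hne : w ≠ []) :
    (completeReturns u w).encard = Fintype.card A := by
  have hwl : 0 < w.length := List.length_pos_iff.2 hne
  set X := (finite_singleOccurrence hrec hw).toFinset with hXdef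
  have hX : ∀ p, p ∈ X ↔ p ∈ singleOccurrence u w := fun p => by simp [hXdef]
  have hsum : ∑ p ∈ X, excess u p = (Fintype.card A : ℤ) - 1 := by
    have := excess_eq_sum_singleOccurrence hrec hneutral hX hw
      (subword_mem_language u 0 0) (by simpa using hne)
    simp only [subword_zero, List.nil_suffix, Finset.filter_true] at this
    rw [← this, excess]
    congr 2
    rw [← Finset.card_univ]
    congr 1
    ext a
    obtain ⟨i, rfl⟩ := hsurj a
    simpa [subword] using subword_mem_language u i 1
  set E := X.biUnion (fun p => (rightExt u p).image (fun b => p ++ [b])) with hE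
  have hmemE : ∀ q, q ∈ E ↔ ∃ p b, p ∈ singleOccurrence u w ∧ p ++ [b] ∈ language u ∧
      q = p ++ [b] := by
    intro q
    simp only [hE, Finset.mem_biUnion, hX, Finset.mem_image, mem_rightExt]
    constructor
    · rintro ⟨p, hp, b, hb, rfl⟩
      exact ⟨p, b, hp, hb, rfl⟩
    · rintro ⟨p, b, hp, hb, rfl⟩
      exact ⟨p, hp, b, hb, rfl⟩
  have hcardE : (E.card : ℤ) = Fintype.card A - 1 + X.card := by
    rw [hE, Finset.card_biUnion]
    · rw [← hsum, Finset.cast_card (s := X), ← Finset.sum_add_distrib]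
      push_cast
      refine Finset.sum_congr rfl fun p _ => ?_
      rw [Finset.card_image_of_injective _ (by intro a b; simp), excess]
      ring
    · intro p _ p' _ hpp
      rw [Function.onFun, Finset.disjoint_left]
      intro q hq hq'
      simp only [Finset.mem_image] at hq hq'
      obtain ⟨b, -, rfl⟩ := hq
      obtain ⟨b', -, h⟩ := hq'
      exact hpp (List.append_inj' h rfl).1.symm
  have hwX : w ∈ X := by
    refine (hX w).2 ⟨hw, List.prefix_rfl, fun h => ?_⟩
    have := h.length_le
    rw [List.length_tail] at this
    omega
  have hne_of : ∀ p, w <+: p → p ≠ [] := by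
    rintro p h rfl
    exact hne (List.prefix_nil.1 h)
  have hE1 : {q ∈ E | ¬ w <:+: q.tail} = X.erase w := by
    ext q
    simp only [Finset.mem_filter, hmemE, Finset.mem_erase, hX]
    constructor
    · rintro ⟨⟨p, b, hp, hb, rfl⟩, hn⟩
      refine ⟨fun h => ?_, hb, hp.2.1.trans (List.prefix_append _ _), hn⟩
      have h1 := hp.2.1.length_le
      rw [← h] at h1
      simp at h1
    · rintro ⟨hqw, hq, hpre, hn⟩
      refine ⟨?_, hn⟩
      rcases List.eq_nil_or_concat' q with rfl | ⟨p, b, rfl⟩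
      · exact absurd rfl (hne_of _ hpre)
      · have hp : w <+: p := by
          rcases List.prefix_concat_iff.1 hpre with h | h
          · exact absurd h.symm hqw
          · exact h
        refine ⟨p, b, ⟨language_of_infix hq (List.prefix_append _ _).isInfix, hp,
          fun h => hn (h.trans ?_)⟩, hq, rfl⟩
        rw [List.tail_append_of_ne_nil (hne_of _ hp)]
        exact (List.prefix_append _ _).isInfix
  have hE2 : completeReturns u w = ({q ∈ E | w <:+: q.tail} : Finset (List A)) := by
    ext q
    simp only [Finset.coe_filter, Set.mem_ofPred_eq, hmemE, completeReturns]
    constructor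
    · rintro ⟨hq, h1, h2, h3⟩
      rcases List.eq_nil_or_concat' q with rfl | ⟨p, b, rfl⟩
      · exact absurd rfl (hne_of _ h1)
      · rw [List.dropLast_concat] at h1 h2
        exact ⟨⟨p, b, ⟨language_of_infix hq (List.prefix_append _ _).isInfix, h1, h2⟩, hq, rfl⟩,
          h3⟩
    · rintro ⟨⟨p, b, ⟨-, h1, h2⟩, hq, rfl⟩, h3⟩
      rw [List.dropLast_concat]
      exact ⟨hq, h1, h2, h3⟩
  have htot := Finset.card_filter_add_card_filter_not (s := E) (fun q => w <:+: q.tail)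
  rw [hE1, Finset.card_erase_of_mem hwX] at htot
  have hXpos : 0 < X.card := Finset.card_pos.2 ⟨w, hwX⟩
  rw [hE2, Set.encard_coe_eq_coe_finsetCard]
  congr 1
  omega

theorem propertyR_of_neutral (hsurj : Function.Surjective u) (hrec : UniformlyRecurrent u)
    (hneutral : ∀ v ∈ language u, excess u v = ∑ a ∈ leftExt u v, excess u (a :: v)) :
    PropertyR u := by
  intro w hw
  by_cases hne : w = []
  · subst hne
    exact encard_returnWords_nil hsurj
  · rw [← encard_completeReturns hne]
    exact encard_completeReturns_of_neutral hsurj hrec hneutral hw hne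

end ReturnWords

/-! ### Walks in connected graphs and in trees. -/

section Graph

variable {V Λ : Type*} [Fintype V]

theorem card_le_card_edges_add_one (F : Finset (Sym2 V))
    (h : (SimpleGraph.fromEdgeSet (F : Set (Sym2 V))).Connected) :
    Fintype.card V ≤ F.card + 1 := by
  have h1 := h.card_vert_le_card_edgeSet_add_one
  rw [Nat.card_eq_fintype_card, SimpleGraph.edgeSet_fromEdgeSet] at h1
  have h2 : Nat.card ((F : Set (Sym2 V)) \ Sym2.diagSet : Set (Sym2 V)) ≤ F.card := by
    rw [Nat.card_coe_set_eq, ← Set.ncard_coe_finset F]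
    exact Set.ncard_le_ncard Set.sdiff_subset
  exact h1.trans (Nat.add_le_add_right h2 1)

theorem card_le_of_surjective_walk {y : ℕ → V} (hy : Function.Surjective y)
    (F : Finset (Sym2 V))
    (h : ∀ t, (SimpleGraph.fromEdgeSet (F : Set (Sym2 V))).Reachable (y t) (y (t + 1))) :
    Fintype.card V ≤ F.card + 1 := by
  apply card_le_card_edges_add_one
  have h0 : ∀ t, (SimpleGraph.fromEdgeSet (F : Set (Sym2 V))).Reachable (y 0) (y t) := by
    intro t
    induction t with
    | zero => rfl
    | succ t ih => exact ih.trans (h t)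
  have : Nonempty V := ⟨y 0⟩
  refine ⟨fun a b => ?_⟩
  obtain ⟨s, rfl⟩ := hy a
  obtain ⟨t, rfl⟩ := hy b
  exact (h0 s).symm.trans (h0 t)

theorem reachable_of_mem_or_eq {V : Type*} {F : Set (Sym2 V)} {a b : V} (h : a ≠ b → s(a, b) ∈ F) :
    (SimpleGraph.fromEdgeSet F).Reachable a b := by
  by_cases hab : a = b
  · rw [hab]
  · exact SimpleGraph.Adj.reachable ((SimpleGraph.fromEdgeSet_adj F).2 ⟨h hab, hab⟩)

/-- A walk all of whose steps lie in `F` visits at most `F.card + 1` vertices. -/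
theorem card_le_of_walk {V : Type*} (y : ℕ → V) (S : Finset V) (hS : ∀ v ∈ S, ∃ t, y t = v)
    [Finite V] (F : Finset (Sym2 V)) (hF : ∀ t, y t ≠ y (t + 1) → s(y t, y (t + 1)) ∈ F) :
    S.card ≤ F.card + 1 := by
  -- Unvisited vertices are discarded so that the graph becomes connected.
  have : Fintype (Set.range y) := Fintype.ofFinite _
  have hinj : Function.Injective (Sym2.map (Subtype.val : Set.range y → V)) :=
    Sym2.map.injective Subtype.val_injective
  have h1 := card_le_of_surjective_walk (V := Set.range y) (y := Set.rangeFactorization y)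
    Set.rangeFactorization_surjective (F.preimage _ hinj.injOn)
    (fun t => reachable_of_mem_or_eq fun hne => by
      rw [Finset.coe_preimage]
      exact hF t fun h => hne (Subtype.ext h))
  have h2 := Finset.card_le_card_of_injOn (s := F.preimage _ hinj.injOn) (t := F) _
    (fun e he => Finset.mem_preimage.1 he) hinj.injOn
  have h3 : S.card ≤ Fintype.card (Set.range y) := by
    rw [← Set.toFinset_card]
    exact Finset.card_le_card fun v hv => by simpa using hS v hv
  omega

/-- If a walk visits more vertices than it uses edges, then between consecutive visits of a
vertex it leaves and comes back through the same edge. -/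
theorem walk_backtracks {y : ℕ → V} (hy : Function.Surjective y) (l : ℕ → Λ)
    (hl : ∀ s t, l s = l t → s(y s, y (s + 1)) = s(y t, y (t + 1)))
    (F : Finset Λ) (hF : ∀ t, y t ≠ y (t + 1) → l t ∈ F) (hcard : F.card < Fintype.card V)
    {i j : ℕ} (hij : i < j) (heq : y j = y i) (hbetween : ∀ m, i < m → m < j → y m ≠ y i)
    (hne : y i ≠ y (i + 1)) : l i = l (j - 1) := by
  by_contra hcon
  -- Edges carry labels because distinct labels might join the same vertices. `e` recovers the
  -- endpoints; its value on labels never used is arbitrary.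
  let e : Λ → Sym2 V := fun x =>
    if h : ∃ t, l t = x then s(y h.choose, y (h.choose + 1)) else s(y 0, y 0)
  have he : ∀ t, e (l t) = s(y t, y (t + 1)) := by
    intro t
    have h : ∃ s, l s = l t := ⟨t, rfl⟩
    simp only [e, dif_pos h]
    exact hl _ _ h.choose_spec
  have hstep : ∀ t, l t ≠ l i → (SimpleGraph.fromEdgeSet
      (((F.erase (l i)).image e : Finset (Sym2 V)) : Set (Sym2 V))).Reachable
        (y t) (y (t + 1)) := by
    intro t ht
    refine reachable_of_mem_or_eq fun hne => ?_
    rw [← he, Finset.mem_coe]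
    exact Finset.mem_image_of_mem _ (Finset.mem_erase.2 ⟨ht, hF t hne⟩)
  -- Between times `i + 1` and `j` the label `l i` is not used: its edge contains `y i`, which is
  -- met again only at time `j`, and the last step has another label by `hcon`.
  have hloop : ∀ m, i + 1 ≤ m → m ≤ j → (SimpleGraph.fromEdgeSet
      (((F.erase (l i)).image e : Finset (Sym2 V)) : Set (Sym2 V))).Reachable
        (y (i + 1)) (y m) := by
    intro m hm
    induction m, hm using Nat.le_induction with
    | base => intro _; rfl
    | succ m hm ih =>
      intro hmj
      refine (ih (by omega)).trans (hstep m fun h => ?_)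
      have h1 : y i ∈ s(y m, y (m + 1)) := by rw [hl _ _ h]; simp
      rcases Sym2.mem_iff.1 h1 with h1 | h1
      · exact hbetween m (by omega) (by omega) h1.symm
      · rcases Nat.lt_or_ge (m + 1) j with h2 | h2
        · exact hbetween (m + 1) (by omega) h2 h1.symm
        · obtain rfl : m = j - 1 := by omega
          exact hcon h.symm
  -- A step with the erased label is replaced by the loop, so the graph stays connected with one
  -- label fewer, too few for its vertices.
  have hmain := card_le_of_surjective_walk hy ((F.erase (l i)).image e) (by
    intro t
    by_cases ht : l t = l i
    · have h1 := hloop j hij le_rfl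
      rw [heq] at h1
      rcases Sym2.eq_iff.1 (hl _ _ ht) with ⟨h2, h3⟩ | ⟨h2, h3⟩
      · rw [h2, h3]; exact h1.symm
      · rw [h2, h3]; exact h1
    · exact hstep t ht)
  have h1 : ((F.erase (l i)).image e).card ≤ (F.erase (l i)).card := Finset.card_image_le
  rw [Finset.card_erase_of_mem (hF i hne)] at h1
  have h2 : 0 < F.card := Finset.card_pos.2 ⟨_, hF i hne⟩
  omega

end Graph

/-! ### Reversal classes and palindromic complexity. -/

section Reversal

/-- The class of a word modulo reversal. -/
def revClass (v : List A) : Sym2 (List A) := s(v, v.reverse)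

theorem revClass_eq_iff {v w : List A} : revClass v = revClass w ↔ v = w ∨ v = w.reverse := by
  rw [revClass, revClass, Sym2.eq_iff]
  constructor
  · rintro (⟨h, -⟩ | ⟨h, -⟩)
    · exact Or.inl h
    · exact Or.inr h
  · rintro (rfl | rfl) <;> simp

/-- A class has two members, or one if it consists of a palindrome, which is then counted twice on
the right. -/
theorem two_mul_card_image_revClass (S : Finset (List A)) (hS : ∀ v ∈ S, v.reverse ∈ S) :
    2 * (S.image revClass).card = S.card + {v ∈ S | v.reverse = v}.card := by
  have hmaps : ∀ v ∈ S, revClass v ∈ S.image revClass := fun v => Finset.mem_image_of_mem _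
  rw [Finset.card_eq_sum_card_fiberwise hmaps,
    Finset.card_eq_sum_card_fiberwise (s := {v ∈ S | v.reverse = v})
      (fun v hv => hmaps v (Finset.mem_filter.1 hv).1),
    ← Finset.sum_add_distrib, mul_comm, ← smul_eq_mul, ← Finset.sum_const]
  refine Finset.sum_congr rfl fun c hc => ?_
  obtain ⟨v, hv, rfl⟩ := Finset.mem_image.1 hc
  have h1 : {x ∈ S | revClass x = revClass v} = {v, v.reverse} := by
    ext x
    simp only [Finset.mem_filter, revClass_eq_iff, Finset.mem_insert, Finset.mem_singleton,
      and_iff_right_iff_imp]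
    rintro (rfl | rfl)
    · exact hv
    · exact hS v hv
  rw [Finset.filter_comm, h1]
  by_cases hp : v.reverse = v
  · simp [hp, Finset.filter_singleton]
  · have : {x ∈ ({v, v.reverse} : Finset (List A)) | x.reverse = x} = ∅ := by
      refine Finset.filter_eq_empty_iff.2 fun x hx => ?_
      rcases Finset.mem_insert.1 hx with rfl | hx
      · exact hp
      · rw [Finset.mem_singleton.1 hx, List.reverse_reverse]
        exact fun h => hp h.symm
    rw [this, Finset.card_pair fun h => hp h.symm, Finset.card_empty]

variable {u : ℕ → A}

theorem PropertyPE.exists_palindrome (hPE : PropertyPE u) (n : ℕ) :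
    ∃ p ∈ language u, p.reverse = p ∧ n ≤ p.length := by
  induction n with
  | zero => exact ⟨[], subword_mem_language u 0 0, rfl, le_rfl⟩
  | succ n ih =>
    obtain ⟨p, hp, hr, hl⟩ := ih
    obtain ⟨-, ⟨hv, a, rfl⟩, -⟩ := hPE p hp (List.Palindrome.of_reverse_eq hr)
    exact ⟨_, hv, by simp [hr], by simp; omega⟩

/-- PE produces arbitrarily long palindromic factors; a long enough one contains `v`, hence also its
reversal. -/
theorem reverse_mem_language (hrec : UniformlyRecurrent u) (hPE : PropertyPE u) {v : List A}
    (hv : v ∈ language u) : v.reverse ∈ language u := by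
  obtain ⟨N, hN⟩ := hrec.exists_infix_of_le hv
  obtain ⟨p, hp, hr, hl⟩ := hPE.exists_palindrome N
  refine language_of_infix hp ?_
  rw [← hr, List.reverse_infix]
  exact hN p hp hl

variable [Fintype A]

/-- The palindromic factors of length `n`. -/
noncomputable def palFactors (u : ℕ → A) (n : ℕ) : Finset (List A) :=
  {v ∈ factors u n | v.reverse = v}

/-- Stripping the two outer letters is a bijection: PE makes it injective and surjective. -/
theorem PropertyPE.card_palFactors_add_two (hPE : PropertyPE u) (n : ℕ) :
    (palFactors u (n + 2)).card = (palFactors u n).card := by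
  have hstrip : ∀ v ∈ palFactors u (n + 2), ∃ a, ∃ p ∈ palFactors u n, v = a :: (p ++ [a]) := by
    intro v hv
    simp only [palFactors, Finset.mem_filter, mem_factors] at hv
    obtain ⟨⟨hv, hl⟩, hr⟩ := hv
    rcases v with _ | ⟨a, v⟩
    · simp at hl
    rcases List.eq_nil_or_concat' v with rfl | ⟨p, b, rfl⟩
    · simp at hl
    simp only [List.reverse_cons, List.reverse_append, List.reverse_nil, List.nil_append,
      List.cons_append, List.cons.injEq] at hr
    obtain ⟨rfl, hr⟩ := hr
    refine ⟨b, p, ?_, rfl⟩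
    simp only [palFactors, Finset.mem_filter, mem_factors]
    exact ⟨⟨language_of_infix hv ⟨[b], [b], by simp⟩, by simpa using hl⟩,
      List.append_cancel_right hr⟩
  refine Finset.card_bij (fun v _ => v.tail.dropLast) ?_ ?_ ?_
  · intro v hv
    obtain ⟨a, p, hp, rfl⟩ := hstrip v hv
    simpa using hp
  · intro v hv v' hv' h
    obtain ⟨a, p, hp, rfl⟩ := hstrip v hv
    obtain ⟨a', p', hp', rfl⟩ := hstrip v' hv'
    simp only [List.tail_cons, List.dropLast_concat] at h
    subst h
    simp only [palFactors, Finset.mem_filter, mem_factors] at hp hv hv'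
    exact (hPE p hp.1.1 (List.Palindrome.of_reverse_eq hp.2)).unique
      ⟨hv.1.1, a, rfl⟩ ⟨hv'.1.1, a', rfl⟩
  · intro p hp
    simp only [palFactors, Finset.mem_filter, mem_factors] at hp
    obtain ⟨-, ⟨hv, a, rfl⟩, -⟩ := hPE p hp.1.1 (List.Palindrome.of_reverse_eq hp.2)
    refine ⟨a :: (p ++ [a]), ?_, by simp⟩
    simp [palFactors, hv, hp.1.2, hp.2]

/-- The palindromic complexity has period 2 and starts with 1 (the empty word) and k (the letters).
-/
theorem PropertyPE.card_palFactors (hPE : PropertyPE u) (hsurj : Function.Surjective u) (n : ℕ) :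
    (palFactors u n).card + (palFactors u (n + 1)).card = Fintype.card A + 1 := by
  induction n with
  | zero =>
    have h0 : palFactors u 0 = {[]} := by
      ext v
      simp only [palFactors, Finset.mem_filter, mem_factors, Finset.mem_singleton,
        List.length_eq_zero_iff]
      constructor
      · exact fun h => h.1.2
      · rintro rfl
        exact ⟨⟨subword_mem_language u 0 0, rfl⟩, rfl⟩
    have h1 : palFactors u 1 = Finset.univ.image (fun a => [a]) := by
      ext v
      simp only [palFactors, Finset.mem_filter, mem_factors, Finset.mem_image, Finset.mem_univ,
        true_and]
      constructor
      · rintro ⟨⟨-, hl⟩, -⟩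
        obtain ⟨a, rfl⟩ := List.length_eq_one_iff.1 hl
        exact ⟨a, rfl⟩
      · rintro ⟨a, rfl⟩
        obtain ⟨i, rfl⟩ := hsurj a
        exact ⟨⟨subword_mem_language u i 1, rfl⟩, rfl⟩
    rw [h0, zero_add, h1, Finset.card_image_of_injective _ (by intro a b; simp),
      Finset.card_univ, Finset.card_singleton, add_comm]
  | succ n ih => rw [hPE.card_palFactors_add_two, add_comm, ih]

end Reversal

/-! ### Factor graphs modulo reversal, and the absence of weak factors. -/

section Backtracking

variable {u : ℕ → A}

theorem subword_eq_reverse {s t n : ℕ}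
    (h : subword u s (n + 1) = (subword u t (n + 1)).reverse) :
    subword u s n = (subword u (t + 1) n).reverse ∧ u (s + n) = u t ∧
      subword u (s + 1) n = (subword u t n).reverse := by
  have h1 := h
  rw [subword_succ, subword_succ_eq_cons u t, List.reverse_cons] at h1
  have h2 := h
  rw [subword_succ_eq_cons, subword_succ u t, List.reverse_append] at h2
  simp only [List.reverse_cons, List.reverse_nil, List.nil_append, List.cons_append,
    List.cons.injEq] at h2
  obtain ⟨h3, h4⟩ := List.append_inj' h1 rfl
  exact ⟨h3, by simpa using h4, h2.2⟩

theorem subword_shift_congr {s t n : ℕ} (h : subword u s (n + 1) = subword u t (n + 1)) :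
    subword u (s + 1) n = subword u (t + 1) n := by
  rw [subword_succ_eq_cons, subword_succ_eq_cons] at h
  exact (List.cons.inj h).2

/-- Reversing a word of length `n + 1` exchanges its prefix and suffix of length `n` up to reversal,
so a class of such words has well-defined endpoints as an edge. -/
theorem revClass_step_congr {s t n : ℕ}
    (h : revClass (subword u s (n + 1)) = revClass (subword u t (n + 1))) :
    s(revClass (subword u s n), revClass (subword u (s + 1) n)) =
      s(revClass (subword u t n), revClass (subword u (t + 1) n)) := by
  rcases revClass_eq_iff.1 h with h | h
  · rw [subword_congr_of_le h (Nat.le_succ n), subword_shift_congr h]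
  · obtain ⟨h1, -, h2⟩ := subword_eq_reverse h
    rw [Sym2.eq_iff]
    exact Or.inr ⟨revClass_eq_iff.2 (Or.inr h1), revClass_eq_iff.2 (Or.inr h2)⟩

theorem apply_add_eq_of_subword_shift {i n : ℕ} (h : subword u (i + 1) n = subword u i n)
    {m : ℕ} (hm : m ≤ n) : u (i + m) = u i := by
  induction m with
  | zero => rfl
  | succ m ih =>
    have h1 := subword_congr_of_le h hm
    rw [subword_succ, subword_succ] at h1
    have h2 := (List.append_inj' h1 rfl).2
    rw [← ih (by omega), add_comm m 1, ← add_assoc]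
    simpa using h2

theorem subword_eq_replicate {i n : ℕ} (h : ∀ m < n, u (i + m) = u i) :
    subword u i n = List.replicate n (u i) := by
  refine List.eq_replicate_iff.2 ⟨by simp, fun b hb => ?_⟩
  simp only [subword, List.mem_map, List.mem_range] at hb
  obtain ⟨m, hm, rfl⟩ := hb
  exact h m hm

theorem reverse_mem_language_iff (hrec : UniformlyRecurrent u) (hPE : PropertyPE u)
    {v : List A} : v.reverse ∈ language u ↔ v ∈ language u :=
  ⟨fun h => by simpa using reverse_mem_language hrec hPE h, reverse_mem_language hrec hPE⟩

variable [Fintype A]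

/-- Between consecutive occurrences of a factor up to reversal, the second one is the reversal of
the first one, and the letter before it is the letter following the first one. -/
theorem subword_backtracks (hsurj : Function.Surjective u) (hrec : UniformlyRecurrent u)
    (hC : PropertyC u) (hPE : PropertyPE u) {n i j : ℕ} (hij : i < j)
    (heq : revClass (subword u j n) = revClass (subword u i n))
    (hbetween : ∀ m, i < m → m < j → revClass (subword u m n) ≠ revClass (subword u i n)) :
    subword u j n = (subword u i n).reverse ∧ u (i + n) = u (j - 1) := by
  -- If the walk stays put, then `j = i + 1`, and the word either equals its shift, so is a power of
  -- one letter, or is reversed by it.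
  by_cases hne : revClass (subword u i n) = revClass (subword u (i + 1) n)
  · obtain rfl : j = i + 1 := by
      by_contra h
      exact hbetween (i + 1) (by omega) (by omega) hne.symm
    rw [Nat.add_sub_cancel]
    rcases revClass_eq_iff.1 heq with h | h
    · have hc : ∀ m ≤ n, u (i + m) = u i := fun m => apply_add_eq_of_subword_shift h
      refine ⟨?_, hc n le_rfl⟩
      rw [h, subword_eq_replicate fun m hm => hc m hm.le, List.reverse_replicate]
    · refine ⟨h, ?_⟩
      rcases n with _ | n
      · rfl
      · rw [← (subword_eq_reverse h).2.1]
        congr 1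
        omega
  · let V := {c // c ∈ (factors u n).image revClass}
    let y : ℕ → V := fun t => ⟨revClass (subword u t n),
      Finset.mem_image_of_mem _ (by simp [subword_mem_language])⟩
    have hy : Function.Surjective y := by
      rintro ⟨c, hc⟩
      obtain ⟨v, hv, rfl⟩ := Finset.mem_image.1 hc
      obtain ⟨⟨t, ht⟩, rfl⟩ := mem_factors.1 hv
      exact ⟨t, Subtype.ext (congrArg revClass ht)⟩
    -- Palindromes of length `n + 1` are left out because they are loops: their prefix and suffix of
    -- length `n` are reversals of each other.
    set S : Finset (List A) := {v ∈ factors u (n + 1) | ¬ v.reverse = v} with hS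
    have hcardV : 2 * Fintype.card V = (factors u n).card + (palFactors u n).card := by
      rw [Fintype.card_coe, two_mul_card_image_revClass, palFactors]
      intro v hv
      simp only [mem_factors, List.length_reverse] at hv ⊢
      exact ⟨reverse_mem_language hrec hPE hv.1, hv.2⟩
    have hcardF : 2 * (S.image revClass).card + (palFactors u (n + 1)).card =
        (factors u (n + 1)).card := by
      rw [two_mul_card_image_revClass]
      · have h0 : {v ∈ S | v.reverse = v} = ∅ :=
          Finset.filter_eq_empty_iff.2 fun v hv => (Finset.mem_filter.1 hv).2
        rw [h0, Finset.card_empty, add_zero, add_comm, palFactors, hS]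
        exact Finset.card_filter_add_card_filter_not _
      · intro v hv
        simp only [hS, Finset.mem_filter, mem_factors, List.length_reverse,
          List.reverse_reverse] at hv ⊢
        exact ⟨⟨reverse_mem_language hrec hPE hv.1.1, hv.1.2⟩, fun h => hv.2 h.symm⟩
    -- With P the palindromic complexity, 2V = (k-1)n + 1 + P(n) and 2F = (k-1)(n+1) + 1 - P(n+1).
    -- As P(n) + P(n+1) = k + 1, this gives V = F + 1.
    have hP := hPE.card_palFactors hsurj n
    rw [card_factors, hC] at hcardV hcardF
    rw [mul_add] at hcardF
    have hA : 0 < Fintype.card A := Fintype.card_pos_iff.2 ⟨u 0⟩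
    have key := walk_backtracks hy (fun t => revClass (subword u t (n + 1)))
      (fun s t h => by
        have h1 := revClass_step_congr h
        apply Sym2.map.injective Subtype.val_injective
        simpa only [Sym2.map_mk] using h1)
      (S.image revClass)
      (fun t ht => by
        refine Finset.mem_image_of_mem _ ?_
        simp only [hS, Finset.mem_filter, mem_factors, length_subword, and_true]
        refine ⟨subword_mem_language _ _ _, fun h => ht (Subtype.ext ?_)⟩
        exact revClass_eq_iff.2 (Or.inr (subword_eq_reverse h.symm).1))
      (by omega) hij (Subtype.ext heq)
      (fun m h1 h2 h3 => hbetween m h1 h2 (congrArg Subtype.val h3))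
      (fun h => hne (congrArg Subtype.val h))
    obtain ⟨d, rfl⟩ : ∃ d, j = d + 1 := ⟨j - 1, by omega⟩
    rw [Nat.add_sub_cancel] at key ⊢
    -- The same edge may be crossed in the same or in the opposite direction; the same direction
    -- would put the class of `i` already at `i + 1`, against `hne`.
    rcases revClass_eq_iff.1 key with h | h
    · exfalso
      rw [subword_shift_congr h, heq] at hne
      exact hne rfl
    · obtain ⟨h1, h2, -⟩ := subword_eq_reverse h
      exact ⟨by rw [h1, List.reverse_reverse], h2⟩

/-- The successive occurrences `z m` of a factor up to reversal, with the letters `x m` that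
separate them. -/
theorem exists_return_walk (hsurj : Function.Surjective u) (hrec : UniformlyRecurrent u)
    (hC : PropertyC u) (hPE : PropertyPE u) {v : List A} (hv : v ∈ language u) :
    ∃ (x : ℕ → A) (z : ℕ → List A), (z 0 = v ∨ z 0 = v.reverse) ∧
      (∀ m, z (m + 1) = (z m).reverse) ∧
      (∀ m, x m :: (z (m + 1) ++ [x (m + 1)]) ∈ language u) ∧
      (∀ b, v ++ [b] ∈ language u → ∃ m, z m = v ∧ x m = b) ∧
      (∀ b, v.reverse ++ [b] ∈ language u → ∃ m, z m = v.reverse ∧ x m = b) := by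
  set n := v.length with hn
  let p : ℕ → Prop := fun i => revClass (subword u i n) = revClass v
  have hinf : (Set.ofPred p).Infinite := by
    refine Set.infinite_of_not_bddAbove ?_
    rintro ⟨N, hN⟩
    obtain ⟨i, hi, ho⟩ := hrec.1.exists_occurrence_gt hv N
    exact absurd (hN (show p i from congrArg revClass ho)) (by omega)
  have hmem : ∀ m, p (Nat.nth p m) := Nat.nth_mem_of_infinite hinf
  have hmono := Nat.nth_strictMono hinf
  have hback : ∀ m, subword u (Nat.nth p (m + 1)) n = (subword u (Nat.nth p m) n).reverse ∧
      u (Nat.nth p m + n) = u (Nat.nth p (m + 1) - 1) := by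
    intro m
    refine subword_backtracks hsurj hrec hC hPE (hmono (Nat.lt_succ_self m))
      ((hmem _).trans (hmem _).symm) fun k h1 h2 h3 => ?_
    have hk : p k := h3.trans (hmem m)
    rw [← Nat.nth_count hk] at h1 h2
    have h4 := hmono.lt_iff_lt.1 h1
    have h5 := hmono.lt_iff_lt.1 h2
    omega
  refine ⟨fun m => u (Nat.nth p m + n), fun m => subword u (Nat.nth p m) n,
    revClass_eq_iff.1 (hmem 0), fun m => (hback m).1, fun m => ?_, ?_, ?_⟩
  · have hpos : Nat.nth p m < Nat.nth p (m + 1) := hmono (Nat.lt_succ_self m)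
    obtain ⟨d, hd⟩ : ∃ d, Nat.nth p (m + 1) = d + 1 := ⟨Nat.nth p (m + 1) - 1, by omega⟩
    have h1 := (hback m).2
    simp only [hd, Nat.add_sub_cancel] at h1 ⊢
    rw [h1, ← subword_succ, ← subword_succ_eq_cons]
    exact subword_mem_language _ _ _
  · intro b hb
    obtain ⟨i, hi, rfl⟩ := exists_subword_eq_of_append_mem hb
    have hp : p i := congrArg revClass hi
    exact ⟨Nat.count p i, by simp only [Nat.nth_count hp]; exact ⟨hi, rfl⟩⟩
  · intro b hb
    obtain ⟨i, hi, rfl⟩ := exists_subword_eq_of_append_mem hb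
    rw [List.length_reverse] at hi ⊢
    have hp : p i := revClass_eq_iff.2 (Or.inr hi)
    exact ⟨Nat.count p i, by simp only [Nat.nth_count hp]; exact ⟨hi, rfl⟩⟩

/-- The letters `x m` walk through all right extensions, with steps ab such that avb is a factor. So
at least #right - 1 unordered pairs of distinct letters occur, each in both orders by reversal; PE
adds a pair (c, c), and #left = #right. -/
theorem not_weak_of_palindrome (hsurj : Function.Surjective u) (hrec : UniformlyRecurrent u)
    (hC : PropertyC u) (hPE : PropertyPE u) {v : List A} (hv : v ∈ language u)
    (hpal : v.reverse = v) :
    (leftExt u v).card + (rightExt u v).card ≤ (biExt u v).card + 1 := by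
  obtain ⟨x, z, hz0, hz, hxz, hright, -⟩ := exists_return_walk hsurj hrec hC hPE hv
  have hzv : ∀ m, z m = v := by
    intro m
    induction m with
    | zero => simpa [hpal] using hz0
    | succ m ih => rw [hz, ih, hpal]
  simp only [hzv] at hxz
  have hlr : leftExt u v = rightExt u v := by
    ext a
    rw [mem_leftExt, mem_rightExt, ← reverse_mem_language_iff hrec hPE]
    simp [hpal]
  have hsymm : ∀ a b, (a, b) ∈ biExt u v → (b, a) ∈ biExt u v := by
    intro a b h
    rw [mem_biExt] at h ⊢
    rw [← reverse_mem_language_iff hrec hPE]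
    simpa [hpal] using h
  -- An arbitrary linear order on the letters, used to choose one orientation of each pair.
  let e := Fintype.equivFin A
  set T : Finset (A × A) := {q ∈ biExt u v | e q.1 < e q.2} with hT
  have hwalk := card_le_of_walk x (rightExt u v)
    (fun b hb => (hright b (mem_rightExt.1 hb)).imp fun _ h => h.2)
    (T.image fun q => s(q.1, q.2)) (by
      intro t hne
      have hb : (x t, x (t + 1)) ∈ biExt u v := mem_biExt.2 (hxz t)
      rw [Finset.mem_image]
      rcases lt_or_gt_of_ne (e.injective.ne hne) with h | h
      · exact ⟨_, Finset.mem_filter.2 ⟨hb, h⟩, rfl⟩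
      · exact ⟨_, Finset.mem_filter.2 ⟨hsymm _ _ hb, h⟩, Sym2.eq_swap⟩)
  have h1 : (T.image fun q => s(q.1, q.2)).card ≤ T.card := Finset.card_image_le
  obtain ⟨-, ⟨hw, c, rfl⟩, -⟩ := hPE v hv (List.Palindrome.of_reverse_eq hpal)
  have hT' : (T.image Prod.swap).card = T.card :=
    Finset.card_image_of_injective _ Prod.swap_injective
  have hdisj : Disjoint T (T.image Prod.swap) := by
    rw [Finset.disjoint_left]
    intro q hq hq'
    obtain ⟨r, hr, rfl⟩ := Finset.mem_image.1 hq'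
    exact lt_asymm (Finset.mem_filter.1 hq).2 (Finset.mem_filter.1 hr).2
  have hc : (c, c) ∉ T ∪ T.image Prod.swap := by
    simp [hT]
  have hsub : insert (c, c) (T ∪ T.image Prod.swap) ⊆ biExt u v := by
    refine Finset.insert_subset (mem_biExt.2 hw)
      (Finset.union_subset (Finset.filter_subset _ _) fun q hq => ?_)
    obtain ⟨⟨a, b⟩, hr, rfl⟩ := Finset.mem_image.1 hq
    exact hsymm _ _ (Finset.mem_filter.1 hr).1
  have hcard := Finset.card_le_card hsub
  rw [Finset.card_insert_of_notMem hc, Finset.card_union_of_disjoint hdisj, hT'] at hcard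
  rw [hlr]
  omega

/-- The bipartite graph of left against right extensions, with an edge for each two-sided extension,
is connected, so it has at least #left + #right - 1 edges. -/
theorem not_weak_of_not_palindrome (hsurj : Function.Surjective u) (hrec : UniformlyRecurrent u)
    (hC : PropertyC u) (hPE : PropertyPE u) {v : List A} (hv : v ∈ language u)
    (hpal : v.reverse ≠ v) :
    (leftExt u v).card + (rightExt u v).card ≤ (biExt u v).card + 1 := by
  obtain ⟨x, z, hz0, hz, hxz, hright, hleft⟩ := exists_return_walk hsurj hrec hC hPE hv
  have hzv : ∀ m, z m = v ∨ z m = v.reverse := by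
    intro m
    induction m with
    | zero => exact hz0
    | succ m ih =>
      rw [hz]
      rcases ih with h | h <;> simp [h]
  -- A letter following `v` is a right extension; one following the reversal is, after reversing, a
  -- left extension. As `z` alternates, the walk changes side at each step.
  let y : ℕ → A ⊕ A := fun m => if z m = v then Sum.inr (x m) else Sum.inl (x m)
  have hwalk := card_le_of_walk y ((leftExt u v).disjSum (rightExt u v))
    (by
      rintro (a | b) h
      · rw [Finset.inl_mem_disjSum, mem_leftExt, ← reverse_mem_language_iff hrec hPE,
          List.reverse_cons] at h
        obtain ⟨m, hm, rfl⟩ := hleft a h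
        exact ⟨m, by simp [y, hm, hpal]⟩
      · rw [Finset.inr_mem_disjSum, mem_rightExt] at h
        obtain ⟨m, hm, rfl⟩ := hright b h
        exact ⟨m, by simp [y, hm]⟩)
    ((biExt u v).image fun q => s(Sum.inl q.1, Sum.inr q.2)) (by
      intro m _
      have hm := hxz m
      rw [Finset.mem_image]
      rcases hzv m with h | h
      · refine ⟨(x (m + 1), x m), ?_, ?_⟩
        · rw [mem_biExt, ← reverse_mem_language_iff hrec hPE]
          rw [hz, h] at hm
          simpa using hm
        · simp [y, hz, h, hpal, Sym2.eq_swap]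
      · refine ⟨(x m, x (m + 1)), ?_, ?_⟩
        · rw [hz, h, List.reverse_reverse] at hm
          exact mem_biExt.2 hm
        · simp [y, hz, h, hpal])
  rw [Finset.card_disjSum] at hwalk
  exact hwalk.trans (Nat.add_le_add_right Finset.card_image_le 1)

end Backtracking

end InfWord

theorem mainTheorem4 {A : Type*} [Fintype A] (u : ℕ → A)
    (hsurj : Function.Surjective u)
    (hrec : InfWord.UniformlyRecurrent u)
    (hC : InfWord.PropertyC u)
    (hPE : InfWord.PropertyPE u) :
    InfWord.PropertyR u := by
  refine InfWord.propertyR_of_neutral hsurj hrec fun v hv =>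
    InfWord.excess_eq_sum_of_card_le (fun n => ?_) (fun w hw => ?_) hv
  · rw [hC, hC, hC]
    push_cast
    ring
  · by_cases hpal : w.reverse = w
    · exact InfWord.not_weak_of_palindrome hsurj hrec hC hPE hw hpal
    · exact InfWord.not_weak_of_not_palindrome hsurj hrec hC hPE hw hpal
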